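/- Let $\tau\in(3,4)$ and $c_F>0$, and let $F$ be a distribution function with $1-F(x)=\min\{1,\,c_F x^{-(\tau-1)}\}$ for all $x>0$ (that is, the power law $1-F(x)=c_Fx^{-(\tau-1)}$ holds exactly at every $x>0$ at which its right-hand side is at most $1$, and $F(x)=0$ at smaller $x$). Let $W$ be a random variable with distribution function $F$ and assume $\nu:=\mathbb E(W^2)/\mathbb E(W)=1$. For $n\ge1$ define the weights $w_j=[1-F]^{-1}(j/n)$, $1\le j\le n$, where $[1-F]^{-1}(1)=0$ and $[1-F]^{-1}(u)=\inf\{s\in\mathbb R:\ 1-F(s)\le u\}$ for $u\in(0,1)$, and let $l_n=\sum_{i=1}^n w_i$. Let $NR_n(\mathbf w)$ be the random graph on the vertex set $\{1,\dots,n\}$ in which the edges $\{i,j\}$, $1\le i<j\le n$, are present independently of each other, the edge $\{i,j\}$ with probability $1-e^{-w_iw_j/l_n}$, and let $|C_{max}|$ be the number of vertices of a largest connected component of $NR_n(\mathbf w)$. Then there is a constant $c>0$, depending only on $F$, $c_F$ and $\tau$, such that for every $\omega>1$ and all large enough $n$, $$\mathbb P\left(|C_{max}|>\omega\, n^{(\tau-2)/(\tau-1)}\right)\le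 \frac{c}{\omega}.$$ -/

import Mathlib

open MeasureTheory ProbabilityTheory Filter

namespace NorrosReittu

noncomputable section

/-- The generalized inverse `[1 - F]⁻¹` of `1 - F`:
`[1 - F]⁻¹(1) = 0` and `[1 - F]⁻¹(u) = inf {s : 1 - F(s) ≤ u}` for `u ∈ (0, 1)`. -/
def tailInverse (F : ℝ → ℝ) (u : ℝ) : ℝ :=
  if u = 1 then 0 else sInf {s : ℝ | 1 - F s ≤ u}

/-- The vertex weights `w_j = [1 - F]⁻¹(j / n)`, `j = 1, …, n`.
The element `i : Fin n` stands for the vertex `j = i + 1`. -/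
def weight (F : ℝ → ℝ) (n : ℕ) (i : Fin n) : ℝ :=
  tailInverse F (((i : ℕ) + 1 : ℝ) / n)

/-- The parameter `ν = E[W²] / E[W]`, where `W` has law `μ`. -/
def nu (μ : Measure ℝ) : ℝ := (∫ x, x ^ 2 ∂μ) / (∫ x, x ∂μ)

/-- The probability `1 - exp (-w_i w_j / l_n)`, `l_n = ∑ k, w_k`, that the edge `{i, j}` is present,
as an element of `[0, 1]`. (For nonnegative weights this number lies in `[0, 1]`, so that the
projection `Set.projIcc` does not change it.) -/
def edgeProb {n : ℕ} (w : Fin n → ℝ) (i j : Fin n) : unitInterval :=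
  Set.projIcc 0 1 zero_le_one (1 - Real.exp (-(w i * w j / ∑ k, w k)))

/-- The potential edges of a graph on `Fin n`, as ordered pairs `i < j`. -/
abbrev PotentialEdge (n : ℕ) : Type := {e : Fin n × Fin n // e.1 < e.2}

/-- The simple graph on `Fin n` whose edges are the pairs `{i, j}`, `i < j`, for which
`x (i, j)` holds. -/
def graphOf {n : ℕ} (x : PotentialEdge n → Prop) : SimpleGraph (Fin n) :=
  SimpleGraph.fromRel fun i j => ∃ h : i < j, x ⟨(i, j), h⟩

/-- The law of the random graph `NR_n(w)`: the edges are present independently, the edge `{i, j}`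
with probability `1 - exp (-w_i w_j / l_n)`. -/
def law {n : ℕ} (w : Fin n → ℝ) : Measure (SimpleGraph (Fin n)) :=
  (Measure.pi fun e : PotentialEdge n =>
    bernoulliMeasure True False (edgeProb w e.1.1 e.1.2)).map graphOf

/-- The component `C(v) = {u : v ↔ u}` of the vertex `v`. -/
def cluster {n : ℕ} (G : SimpleGraph (Fin n)) (v : Fin n) : Set (Fin n) :=
  {u | G.Reachable v u}

/-- The size `|C_max| = max_v |C(v)|` of a largest component. -/
def maxClusterSize {n : ℕ} (G : SimpleGraph (Fin n)) : ℕ :=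
  Finset.univ.sup fun v => (cluster G v).ncard

end

end NorrosReittu

namespace NorrosReittu

/-! Two vertices in one component are joined by a self-avoiding path, so `|C_max|²` is at most the
number of such paths. With `L = ∑ w_j`, `Q = ∑ w_j²` and `Q < L`, the expected number of paths is a
geometric series bounded by `n + L²/(L - Q)` (`sum_edgeLaw_real_isPathMap_le`), and Markov's
inequality applies.

Although `ν = 1`, the discrete weights are slightly subcritical. Put `a = 1/(τ-1)`. Criticality
makes the order-`n` terms of `L` and `Q` cancel, while replacing integrals by sums costs `Q` order
`n^(2a)` but `L` only order `n^a`. Hence `L - Q` is at least of order `n^(2a)`, and `L²/(L - Q)` is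
at most of order `n^(2(1-a))`, the square of the claimed scale (`sq_div_sub_le`). -/

/-! ### Independent edges and self-avoiding paths -/

lemma coe_edgeProb_le {n : ℕ} {w : Fin n → ℝ} (hw : ∀ i, 0 ≤ w i) (i j : Fin n) :
    (edgeProb w i j : ℝ) ≤ w i * w j / ∑ k, w k := by
  have h0 : 0 ≤ w i * w j / ∑ k, w k :=
    div_nonneg (mul_nonneg (hw i) (hw j)) (Finset.sum_nonneg fun k _ => hw k)
  have h1 := Real.add_one_le_exp (-(w i * w j / ∑ k, w k))
  rw [edgeProb, Set.coe_projIcc]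
  exact max_le h0 ((min_le_right _ _).trans (by linarith))

/-- The independent indicators of the potential edges. -/
noncomputable abbrev edgeLaw {n : ℕ} (w : Fin n → ℝ) : Measure (PotentialEdge n → Prop) :=
  Measure.pi fun e : PotentialEdge n => bernoulliMeasure True False (edgeProb w e.1.1 e.1.2)

lemma edgeLaw_real_forall {n : ℕ} (w : Fin n → ℝ) (S : Finset (PotentialEdge n)) :
    (edgeLaw w).real {x | ∀ e ∈ S, x e} = ∏ e ∈ S, (edgeProb w e.1.1 e.1.2 : ℝ) := by
  have h : {x : PotentialEdge n → Prop | ∀ e ∈ S, x e} =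
      (S : Set (PotentialEdge n)).pi fun _ => {True} := by
    ext x
    simp [Set.mem_pi]
  rw [h, measureReal_def, Measure.pi_pi_finset, ENNReal.toReal_prod]
  refine Finset.prod_congr rfl fun e _ => ?_
  rw [← measureReal_def, bernoulliMeasure_real_apply_of_mem_of_notMem _ (by simp) (by simp)
    (by simp)]

lemma measurable_graphOf {n : ℕ} : Measurable (graphOf (n := n)) :=
  .of_discrete

lemma measurableSet_simpleGraph {V : Type*} [Finite V] (s : Set (SimpleGraph V)) :
    MeasurableSet s := by
  have : MeasurableSingletonClass (SimpleGraph V) := ⟨fun G => by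
    have h : {G} = SimpleGraph.Adj ⁻¹' {G.Adj} := by
      ext H
      simp
    rw [h]
    exact SimpleGraph.measurable_adj (.singleton _)⟩
  exact s.toFinite.measurableSet

lemma law_real {n : ℕ} (w : Fin n → ℝ) (s : Set (SimpleGraph (Fin n))) :
    (law w).real s = (edgeLaw w).real (graphOf ⁻¹' s) :=
  map_measureReal_apply measurable_graphOf (measurableSet_simpleGraph s)

/-- The unordered pair `{a, b}` as a potential edge. -/
def potentialEdge {n : ℕ} {a b : Fin n} (h : a ≠ b) : PotentialEdge n :=
  ⟨(min a b, max a b), min_lt_max.2 h⟩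

lemma graphOf_adj {n : ℕ} {x : PotentialEdge n → Prop} {a b : Fin n} (h : a ≠ b) :
    (graphOf x).Adj a b ↔ x (potentialEdge h) := by
  rcases lt_or_gt_of_ne h with h' | h'
  · simp [graphOf, potentialEdge, h'.le, h', h, h'.not_gt]
  · simp [graphOf, potentialEdge, h'.le, h', h, h'.not_gt]

lemma potentialEdge_eq {n : ℕ} {a b c d : Fin n} {h : a ≠ b} {h' : c ≠ d}
    (heq : potentialEdge h = potentialEdge h') : a = c ∧ b = d ∨ a = d ∧ b = c := by
  simp only [potentialEdge, Subtype.mk.injEq, Prod.mk.injEq] at heq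
  grind

/-- The event that `f` is a self-avoiding path in `G`. -/
def IsPathMap {n k : ℕ} (G : SimpleGraph (Fin n)) (f : Fin (k + 1) → Fin n) : Prop :=
  Function.Injective f ∧ ∀ i : Fin k, G.Adj (f i.castSucc) (f i.succ)

lemma edgeLaw_real_isPathMap_le {n k : ℕ} {w : Fin n → ℝ} (hw : ∀ i, 0 ≤ w i)
    (f : Fin (k + 1) → Fin n) :
    (edgeLaw w).real {x | IsPathMap (graphOf x) f} ≤
      ∏ i : Fin k, w (f i.castSucc) * w (f i.succ) / ∑ j, w j := by
  have hL : 0 ≤ ∑ k, w k := Finset.sum_nonneg fun k _ => hw k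
  by_cases hf : Function.Injective f
  · have hne (i : Fin k) : f i.castSucc ≠ f i.succ := fun h =>
      (Fin.castSucc_lt_succ (i := i)).ne (hf h)
    let e (i : Fin k) : PotentialEdge n := potentialEdge (hne i)
    have he : Function.Injective e := by
      intro i j hij
      rcases potentialEdge_eq hij with ⟨h, -⟩ | ⟨h, h'⟩
      · exact Fin.castSucc_injective _ (hf h)
      -- The same edge traversed backwards would force `i = j + 1` and `i + 1 = j`.
      · have h1 := congrArg Fin.val (hf h)
        have h2 := congrArg Fin.val (hf h')
        simp at h1 h2
        omega
    have hset : {x : PotentialEdge n → Prop | IsPathMap (graphOf x) f} =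
        {x | ∀ d ∈ Finset.univ.map ⟨e, he⟩, x d} := by
      ext x
      simp [IsPathMap, hf, graphOf_adj (hne _), e]
    rw [hset, edgeLaw_real_forall, Finset.prod_map]
    refine Finset.prod_le_prod (fun i _ => unitInterval.nonneg _) fun i _ => ?_
    refine (coe_edgeProb_le hw _ _).trans_eq ?_
    rcases le_total (f i.castSucc) (f i.succ) with h | h <;>
      simp [e, potentialEdge, h, mul_comm]
  · simp only [IsPathMap, hf, false_and, Set.ofPred_false, measureReal_empty]
    exact Finset.prod_nonneg fun i _ => div_nonneg (mul_nonneg (hw _) (hw _)) hL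

/-- Each interior vertex lies in two factors and contributes `∑ w² / ∑ w`; the free endpoint
contributes `∑ w / ∑ w = 1`. -/
lemma sum_prod_path {n : ℕ} {w : Fin n → ℝ} (hL : ∑ j, w j ≠ 0) (k : ℕ) (a : Fin n) :
    ∑ g : Fin (k + 1) → Fin n, ∏ i : Fin (k + 1),
        w ((Fin.cons a g : Fin (k + 2) → Fin n) i.castSucc) *
          w ((Fin.cons a g : Fin (k + 2) → Fin n) i.succ) / ∑ j, w j =
      w a * ((∑ j, w j ^ 2) / ∑ j, w j) ^ k := by
  induction k generalizing a with
  | zero =>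
    rw [← (Equiv.funUnique (Fin 1) (Fin n)).symm.sum_comp]
    simp [← Finset.mul_sum, ← Finset.sum_div, hL]
  | succ k ih =>
    rw [← (Fin.consEquiv fun _ => Fin n).sum_comp, Fintype.sum_prod_type]
    have h (b : Fin n) : ∑ g : Fin (k + 1) → Fin n, ∏ i : Fin (k + 2),
        w ((Fin.cons a (Fin.cons b g : Fin (k + 2) → Fin n) : Fin (k + 3) → Fin n) i.castSucc) *
          w ((Fin.cons a (Fin.cons b g : Fin (k + 2) → Fin n) : Fin (k + 3) → Fin n) i.succ) /
            ∑ j, w j =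
        w a * w b / (∑ j, w j) * (w b * ((∑ j, w j ^ 2) / ∑ j, w j) ^ k) := by
      rw [← ih b, Finset.mul_sum]
      refine Finset.sum_congr rfl fun g _ => ?_
      rw [Fin.prod_univ_succ]
      simp only [← Fin.succ_castSucc, Fin.cons_succ, Fin.castSucc_zero, Fin.cons_zero]
    refine (Finset.sum_congr rfl fun b _ => h b).trans ?_
    rw [pow_succ, Finset.sum_div, Finset.mul_sum, Finset.mul_sum]
    refine Finset.sum_congr rfl fun b _ => ?_
    ring

/-- The expected number of self-avoiding paths, in a subcritical weight sequence. -/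
lemma sum_edgeLaw_real_isPathMap_le {n : ℕ} {w : Fin n → ℝ} (hw : ∀ i, 0 ≤ w i)
    (hQ : ∑ j, w j ^ 2 < ∑ j, w j) (m : ℕ) :
    ∑ k ∈ Finset.range m, ∑ f : Fin (k + 1) → Fin n,
        (edgeLaw w).real {x | IsPathMap (graphOf x) f} ≤
      n + (∑ j, w j) ^ 2 / (∑ j, w j - ∑ j, w j ^ 2) := by
  have hQ0 : 0 ≤ ∑ j, w j ^ 2 := Finset.sum_nonneg fun k _ => sq_nonneg _
  have hL : 0 < ∑ j, w j := hQ0.trans_lt hQ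
  have hgeom (k : ℕ) : ∑ f : Fin (k + 2) → Fin n,
      (edgeLaw w).real {x | IsPathMap (graphOf x) f} ≤
        (∑ j, w j) * ((∑ j, w j ^ 2) / ∑ j, w j) ^ k := by
    refine (Finset.sum_le_sum fun f _ => edgeLaw_real_isPathMap_le hw f).trans_eq ?_
    rw [← (Fin.consEquiv fun _ => Fin n).sum_comp, Fintype.sum_prod_type, Finset.sum_mul]
    exact Finset.sum_congr rfl fun a _ => sum_prod_path hL.ne' k a
  have hone : ∑ f : Fin 1 → Fin n, (edgeLaw w).real {x | IsPathMap (graphOf x) f} ≤ n := by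
    refine (Finset.sum_le_sum fun f _ => edgeLaw_real_isPathMap_le hw f).trans_eq ?_
    simp
  have hr0 : 0 ≤ (∑ j, w j ^ 2) / ∑ j, w j := by positivity
  have hr1 : (∑ j, w j ^ 2) / ∑ j, w j < 1 := (div_lt_one hL).2 hQ
  have hsum : (∑ j, w j) ^ 2 / (∑ j, w j - ∑ j, w j ^ 2) =
      (∑ j, w j) * (1 - (∑ j, w j ^ 2) / ∑ j, w j)⁻¹ := by
    have : ∑ j, w j - ∑ j, w j ^ 2 ≠ 0 := (sub_pos.2 hQ).ne'
    rw [one_sub_div hL.ne', inv_div]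
    ring
  rw [hsum]
  cases m with
  | zero =>
    have := inv_nonneg.2 (sub_pos.2 hr1).le
    simp only [Finset.range_zero, Finset.sum_empty]
    positivity
  | succ m =>
    rw [Finset.sum_range_succ', add_comm]
    refine add_le_add hone ((Finset.sum_le_sum fun k _ => hgeom k).trans ?_)
    rw [← Finset.mul_sum]
    refine mul_le_mul_of_nonneg_left ?_ hL.le
    rw [← tsum_geometric_of_lt_one hr0 hr1]
    exact (summable_geometric_of_lt_one hr0 hr1).sum_le_tsum _ fun _ _ => by positivity

/-! ### From the largest component to path counts -/

lemma exists_isPathMap {n : ℕ} {G : SimpleGraph (Fin n)} {a b : Fin n} (h : G.Reachable a b) :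
    ∃ p : (k : Fin n) × (Fin (k + 1) → Fin n),
      IsPathMap G p.2 ∧ p.2 0 = a ∧ p.2 (Fin.last _) = b := by
  obtain ⟨p, hp⟩ := h.exists_isPath
  have hlt : p.length < n := by simpa using hp.length_lt
  refine ⟨⟨⟨p.length, hlt⟩, fun i => p.getVert i⟩, ⟨?_, ?_⟩, ?_, ?_⟩
  · intro i j hij
    exact Fin.ext (hp.getVert_injOn (Nat.lt_succ_iff.1 i.2) (Nat.lt_succ_iff.1 j.2) hij)
  · intro i
    simpa using p.adj_getVert_succ i.2
  · simp
  · simp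

-- Choose a path for each ordered pair of vertices of a largest component; its endpoints recover the
-- pair, so the choice is injective.
open Classical in
lemma maxClusterSize_sq_le {n : ℕ} (G : SimpleGraph (Fin n)) :
    maxClusterSize G ^ 2 ≤
      (Finset.univ.filter fun p : (k : Fin n) × (Fin (k + 1) → Fin n) => IsPathMap G p.2).card := by
  rcases Nat.eq_zero_or_pos n with rfl | hn
  · simp [maxClusterSize]
  obtain ⟨v, -, hv⟩ := Finset.exists_mem_eq_sup (Finset.univ : Finset (Fin n)) ⟨⟨0, hn⟩, by simp⟩
    fun v => (cluster G v).ncard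
  rw [maxClusterSize, hv, Set.ncard_eq_toFinset_card', sq, ← Finset.card_product]
  have hex (q : Fin n × Fin n) : ∃ p : (k : Fin n) × (Fin (k + 1) → Fin n),
      q ∈ (cluster G v).toFinset ×ˢ (cluster G v).toFinset →
        IsPathMap G p.2 ∧ p.2 0 = q.1 ∧ p.2 (Fin.last _) = q.2 := by
    by_cases hq : q ∈ (cluster G v).toFinset ×ˢ (cluster G v).toFinset
    · obtain ⟨h1, h2⟩ := Finset.mem_product.1 hq
      have h1 : q.1 ∈ cluster G v := Set.mem_toFinset.1 h1
      have h2 : q.2 ∈ cluster G v := Set.mem_toFinset.1 h2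
      obtain ⟨p, hp⟩ := exists_isPathMap (SimpleGraph.Reachable.trans (SimpleGraph.Reachable.symm h1) h2)
      exact ⟨p, fun _ => hp⟩
    · exact ⟨⟨⟨0, hn⟩, fun _ => ⟨0, hn⟩⟩, fun h => absurd h hq⟩
  choose p hp using hex
  refine Finset.card_le_card_of_injOn p (fun q hq => by simpa using (hp q hq).1) ?_
  intro q hq q' hq' heq
  have h1 := hp q hq
  have h2 := hp q' hq'
  rw [heq] at h1
  exact Prod.ext (h1.2.1.symm.trans h2.2.1) (h1.2.2.symm.trans h2.2.2)

/-- Markov's inequality for the susceptibility of a subcritical weight sequence. -/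
theorem law_real_lt_maxClusterSize_le {n : ℕ} {w : Fin n → ℝ} (hw : ∀ i, 0 ≤ w i)
    (hQ : ∑ j, w j ^ 2 < ∑ j, w j) {K : ℝ} (hK : 0 < K) :
    (law w).real {G | K < (maxClusterSize G : ℝ)} ≤
      (n + (∑ j, w j) ^ 2 / (∑ j, w j - ∑ j, w j ^ 2)) / K ^ 2 := by
  classical
  let Z (x : PotentialEdge n → Prop) : ℝ :=
    ∑ p : (k : Fin n) × (Fin (k + 1) → Fin n),
      Set.indicator {x | IsPathMap (graphOf x) p.2} (fun _ => (1 : ℝ)) x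
  rw [law_real, le_div_iff₀ (by positivity), mul_comm]
  have hsub : graphOf ⁻¹' {G : SimpleGraph (Fin n) | K < (maxClusterSize G : ℝ)} ⊆
      {x | K ^ 2 ≤ Z x} := by
    intro x hx
    have hx' : K < (maxClusterSize (graphOf x) : ℝ) := hx
    have h1 : ((maxClusterSize (graphOf x) : ℝ)) ^ 2 ≤ Z x := by
      simp only [Z, Set.indicator_apply, Set.mem_ofPred_eq, Finset.sum_boole]
      exact_mod_cast maxClusterSize_sq_le (graphOf x)
    exact (pow_le_pow_left₀ hK.le hx'.le 2).trans h1
  have hZ : 0 ≤ᵐ[edgeLaw w] Z := ae_of_all _ fun x =>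
    Finset.sum_nonneg fun p _ => Set.indicator_nonneg (fun _ _ => zero_le_one) _
  calc K ^ 2 * (edgeLaw w).real (graphOf ⁻¹' {G | K < (maxClusterSize G : ℝ)})
      ≤ K ^ 2 * (edgeLaw w).real {x | K ^ 2 ≤ Z x} :=
        mul_le_mul_of_nonneg_left (measureReal_mono hsub (measure_ne_top _ _)) (sq_nonneg K)
    _ ≤ ∫ x, Z x ∂(edgeLaw w) := mul_meas_ge_le_integral_of_nonneg hZ .of_finite _
    _ = ∑ p : (k : Fin n) × (Fin (k + 1) → Fin n),
          (edgeLaw w).real {x | IsPathMap (graphOf x) p.2} := by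
        rw [integral_finsetSum _ fun p _ => .of_finite]
        refine Finset.sum_congr rfl fun p _ => ?_
        rw [integral_indicator_const _ .of_discrete, smul_eq_mul, mul_one]
    _ = ∑ k ∈ Finset.range n, ∑ f : Fin (k + 1) → Fin n,
          (edgeLaw w).real {x | IsPathMap (graphOf x) f} := by
        rw [Fintype.sum_sigma, Finset.sum_range]
    _ ≤ _ := sum_edgeLaw_real_isPathMap_le hw hQ n

/-! ### The Pareto law and the criticality condition -/

/-- Taking `A = t` yields the moments, and `p = 0` the tail. -/
lemma setIntegral_Ioi_paretoPDFReal_mul_pow {t r A : ℝ} {p : ℕ} (hA : t ≤ A) (hA0 : 0 < A)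
    (hp : (p : ℝ) < r) :
    ∫ x in Set.Ioi A, paretoPDFReal t r x * x ^ p = r * t ^ r * A ^ (p - r) / (r - p) := by
  have h : ∀ x ∈ Set.Ioi A, paretoPDFReal t r x * x ^ p = r * t ^ r * x ^ (p - r - 1) := by
    intro x hx
    have hx' : A < x := hx
    have hx0 : 0 < x := hA0.trans hx'
    rw [paretoPDFReal, if_pos (hA.trans hx'.le), mul_assoc, ← Real.rpow_natCast,
      ← Real.rpow_add hx0]
    congr 2
    ring
  rw [setIntegral_congr_fun measurableSet_Ioi h, integral_const_mul,
    integral_Ioi_rpow_of_lt (by linarith) hA0]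
  rw [show (p : ℝ) - r - 1 + 1 = p - r by ring, ← neg_sub r (p : ℝ), div_neg, neg_div, neg_neg]
  ring

lemma integral_pow_paretoMeasure {t r : ℝ} {p : ℕ} (ht : 0 < t) (hp : (p : ℝ) < r) :
    ∫ x, x ^ p ∂(paretoMeasure t r) = r * t ^ p / (r - p) := by
  have hr : 0 ≤ r := (Nat.cast_nonneg p).trans hp.le
  have h1 : ∫ x, x ^ p ∂(paretoMeasure t r) = ∫ x, paretoPDFReal t r x * x ^ p := by
    rw [paretoMeasure, integral_withDensity_eq_integral_toReal_smul
      (by fun_prop [paretoPDF]) (ae_of_all _ fun x => by simp [paretoPDF])]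
    simp [paretoPDF, ENNReal.toReal_ofReal (paretoPDFReal_nonneg ht.le hr _)]
  have h2 : ∫ x in Set.Ici t, paretoPDFReal t r x * x ^ p = ∫ x, paretoPDFReal t r x * x ^ p :=
    setIntegral_eq_integral_of_forall_compl_eq_zero fun x hx => by
      simp only [Set.mem_Ici] at hx
      simp [paretoPDFReal, hx]
  rw [h1, ← h2, integral_Ici_eq_integral_Ioi, setIntegral_Ioi_paretoPDFReal_mul_pow le_rfl ht hp,
    mul_assoc, ← Real.rpow_add ht, add_sub_cancel, Real.rpow_natCast]

lemma paretoMeasure_real_Ioi {t r A : ℝ} (ht : 0 < t) (hr : 0 < r) (hA : t ≤ A) :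
    (paretoMeasure t r).real (Set.Ioi A) = (t / A) ^ r := by
  have hA0 := ht.trans_le hA
  have h := setIntegral_Ioi_paretoPDFReal_mul_pow (p := 0) hA hA0 (by simpa using hr)
  rw [measureReal_def, paretoMeasure, withDensity_apply _ measurableSet_Ioi]
  simp only [pow_zero, mul_one, CharP.cast_eq_zero, zero_sub, sub_zero] at h
  rw [Real.div_rpow ht.le hA0.le]
  rw [Real.rpow_neg hA0.le] at h
  unfold paretoPDF
  rw [← integral_eq_lintegral_of_nonneg_ae
    (ae_of_all _ fun x => paretoPDFReal_nonneg ht.le hr.le x) (by fun_prop), h]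
  field_simp

/-- A probability measure with an exact power-law tail is a Pareto measure. -/
lemma eq_paretoMeasure (μ : Measure ℝ) [IsProbabilityMeasure μ] {r c : ℝ}
    (hr : 0 < r) (hc : 0 < c) (hF : ∀ x : ℝ, 0 < x → 1 - cdf μ x = min 1 (c * x ^ (-r))) :
    μ = paretoMeasure (c ^ r⁻¹) r := by
  have ht : 0 < c ^ r⁻¹ := by positivity
  have : IsProbabilityMeasure (paretoMeasure (c ^ r⁻¹) r) :=
    isProbabilityMeasure_paretoMeasure ht hr
  refine Measure.eq_of_cdf _ _ ?_
  have hpow : (c ^ r⁻¹) ^ r = c := Real.rpow_inv_rpow hc.le hr.ne'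
  have hμ (x : ℝ) (hx : c ^ r⁻¹ ≤ x) : cdf μ x = 1 - c * x ^ (-r) := by
    have hx0 := ht.trans_le hx
    have h := hF x hx0
    have hle : c * x ^ (-r) ≤ 1 := by
      rw [Real.rpow_neg hx0.le, ← div_eq_mul_inv, div_le_one (by positivity)]
      calc c = (c ^ r⁻¹) ^ r := hpow.symm
        _ ≤ x ^ r := by gcongr
    rw [min_eq_right hle] at h
    linarith
  have hν (x : ℝ) (hx : c ^ r⁻¹ ≤ x) : cdf (paretoMeasure (c ^ r⁻¹) r) x = 1 - c * x ^ (-r) := by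
    have hx0 := ht.trans_le hx
    rw [cdf_eq_real, ← Set.compl_Ioi, probReal_compl_eq_one_sub measurableSet_Ioi,
      paretoMeasure_real_Ioi ht hr hx, Real.div_rpow ht.le hx0.le, hpow, Real.rpow_neg hx0.le,
      div_eq_mul_inv]
  -- `hF` is silent for `x ≤ 0`; vanishing at the left endpoint and monotonicity cover everything
  -- below it.
  have hzero (ρ : Measure ℝ) (h : cdf ρ (c ^ r⁻¹) = 0) (x : ℝ) (hx : x ≤ c ^ r⁻¹) :
      cdf ρ x = 0 := le_antisymm (h ▸ monotone_cdf ρ hx) (cdf_nonneg ρ x)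
  have h0 : 1 - c * (c ^ r⁻¹) ^ (-r) = 0 := by
    rw [Real.rpow_neg ht.le, hpow, mul_inv_cancel₀ hc.ne', sub_self]
  ext x
  rcases le_total (c ^ r⁻¹) x with hx | hx
  · rw [hμ x hx, hν x hx]
  · rw [hzero μ ((hμ _ le_rfl).trans h0) x hx, hzero _ ((hν _ le_rfl).trans h0) x hx]

lemma nu_paretoMeasure {t r : ℝ} (ht : 0 < t) (hr : 2 < r) :
    nu (paretoMeasure t r) = t * (r - 1) / (r - 2) := by
  have h1 := integral_pow_paretoMeasure (p := 1) (r := r) ht (by norm_num; linarith)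
  have h2 := integral_pow_paretoMeasure (p := 2) (r := r) ht (by exact_mod_cast hr)
  simp only [pow_one, Nat.cast_one, Nat.cast_ofNat] at h1 h2
  have h3 : r - 1 ≠ 0 := by linarith
  have h4 : r - 2 ≠ 0 := by linarith
  rw [nu, h1, h2]
  field_simp

/-! ### Explicit weights and their power sums -/

lemma tailInverse_eq {F : ℝ → ℝ} (hmono : Monotone F) {r c : ℝ} (hr : 0 < r) (hc : 0 < c)
    (hF : ∀ x : ℝ, 0 < x → 1 - F x = min 1 (c * x ^ (-r))) {u : ℝ} (hu0 : 0 < u) (hu1 : u < 1) :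
    tailInverse F u = c ^ r⁻¹ * u ^ (-r⁻¹) := by
  have ha : 0 < c ^ r⁻¹ * u ^ (-r⁻¹) := by positivity
  have hpos (s : ℝ) (hs : 0 < s) : 1 - F s ≤ u ↔ c ^ r⁻¹ * u ^ (-r⁻¹) ≤ s := by
    have h : c ^ r⁻¹ * u ^ (-r⁻¹) = (c / u) ^ r⁻¹ := by
      rw [Real.div_rpow hc.le hu0.le, Real.rpow_neg hu0.le, div_eq_mul_inv]
    rw [hF s hs, min_le_iff, or_iff_right hu1.not_ge, h,
      Real.rpow_inv_le_iff_of_pos (by positivity) hs.le hr, div_le_iff₀ hu0,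
      Real.rpow_neg hs.le, ← div_eq_mul_inv, div_le_iff₀ (by positivity), mul_comm]
  have hset : {s : ℝ | 1 - F s ≤ u} = Set.Ici (c ^ r⁻¹ * u ^ (-r⁻¹)) := by
    ext s
    simp only [Set.mem_ofPred_eq, Set.mem_Ici]
    rcases lt_or_ge 0 s with hs | hs
    · exact hpos s hs
    -- The tail formula needs a positive argument, so monotonicity transfers the claim to half the
    -- quantile.
    · refine iff_of_false (fun h => ?_) (hs.trans_lt ha).not_ge
      have h1 : 1 - F (c ^ r⁻¹ * u ^ (-r⁻¹) / 2) ≤ u :=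
        (sub_le_sub_left (hmono (hs.trans (by positivity))) 1).trans h
      have h2 := (hpos _ (by positivity)).1 h1
      linarith
  rw [tailInverse, if_neg hu1.ne, hset, csInf_Ici]

lemma sum_weight_pow {F : ℝ → ℝ} (hmono : Monotone F) {r c : ℝ} (hr : 0 < r) (hc : 0 < c)
    (hF : ∀ x : ℝ, 0 < x → 1 - F x = min 1 (c * x ^ (-r))) (m : ℕ) {p : ℕ} (hp : p ≠ 0) :
    ∑ i, weight F (m + 1) i ^ p = (c ^ r⁻¹) ^ p * ((m : ℝ) + 1) ^ (p * r⁻¹) *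
      ∑ k ∈ Finset.range m, ((k : ℝ) + 1) ^ (-(p * r⁻¹)) := by
  have hm : (0 : ℝ) < m + 1 := by positivity
  rw [Fin.sum_univ_castSucc, Finset.mul_sum, Finset.sum_range]
  -- The last vertex has `u = 1`, hence weight `0`: only `m` terms remain.
  have hlast : weight F (m + 1) (Fin.last m) = 0 := by
    simp [weight, tailInverse, div_self hm.ne']
  rw [hlast, zero_pow hp, add_zero]
  refine Finset.sum_congr rfl fun i _ => ?_
  have hi : ((i : ℕ) : ℝ) + 1 < m + 1 := by
    have : ((i : ℕ) : ℝ) < m := by exact_mod_cast i.2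
    linarith
  have hi0 : (0 : ℝ) < (i : ℕ) + 1 := by positivity
  simp only [weight, Fin.val_castSucc, Nat.cast_add, Nat.cast_one]
  rw [tailInverse_eq hmono hr hc hF (by positivity) ((div_lt_one hm).2 hi),
    Real.div_rpow hi0.le hm.le, Real.rpow_neg hm.le, div_inv_eq_mul, mul_pow, mul_pow,
    ← Real.rpow_mul_natCast hm.le, ← Real.rpow_mul_natCast hi0.le]
  ring_nf

lemma weight_nonneg {F : ℝ → ℝ} (hmono : Monotone F) {r c : ℝ} (hr : 0 < r) (hc : 0 < c)
    (hF : ∀ x : ℝ, 0 < x → 1 - F x = min 1 (c * x ^ (-r))) (n : ℕ) (i : Fin n) :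
    0 ≤ weight F n i := by
  have hi : ((i : ℕ) : ℝ) + 1 ≤ n := by exact_mod_cast i.2
  have hn : (0 : ℝ) < n := lt_of_lt_of_le (by positivity) hi
  rcases hi.eq_or_lt with h | h
  · simp [weight, tailInverse, h, hn.ne']
  · rw [weight, tailInverse_eq hmono hr hc hF (by positivity) ((div_lt_one hn).2 h)]
    positivity

lemma rpow_add_le {x s p : ℝ} (hx : 0 < x) (hs : 0 ≤ x + s) (hp0 : 0 ≤ p) (hp1 : p ≤ 1) :
    (x + s) ^ p ≤ x ^ p + s * (p * x ^ (p - 1)) := by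
  have h1 : -1 ≤ s / x := by rw [le_div_iff₀ hx]; linarith
  have h2 : x + s = x * (1 + s / x) := by field_simp
  rw [h2, Real.mul_rpow hx.le (by linarith), Real.rpow_sub_one hx.ne']
  calc x ^ p * (1 + s / x) ^ p ≤ x ^ p * (1 + p * (s / x)) := by
        gcongr
        exact rpow_one_add_le_one_add_mul_self h1 hp0 hp1
    _ = _ := by field_simp

lemma le_mul_sum_rpow {b : ℝ} (hb0 : 0 ≤ b) (hb1 : b ≤ 1) (m : ℕ) :
    ((m : ℝ) + 1) ^ (1 - b) - 1 ≤ (1 - b) * ∑ k ∈ Finset.range m, ((k : ℝ) + 1) ^ (-b) := by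
  induction m with
  | zero => simp
  | succ m ih =>
    have h := rpow_add_le (x := (m : ℝ) + 1) (s := 1) (p := 1 - b) (by positivity) (by positivity)
      (by linarith) (by linarith)
    rw [Finset.sum_range_succ, mul_add]
    push_cast
    rw [show 1 - b - 1 = -b by ring] at h
    linarith

/-- Telescoping the tangent-line bound for a concave power. The saving `b` comes from the first
term, `1 - b` against `1` for the integral over `[0, 1]`; it is the source of subcriticality. -/
lemma mul_sum_rpow_le {b : ℝ} (hb0 : 0 ≤ b) (hb1 : b ≤ 1) (m : ℕ) :
    (1 - b) * ∑ k ∈ Finset.range (m + 1), ((k : ℝ) + 1) ^ (-b) ≤ ((m : ℝ) + 1) ^ (1 - b) - b := by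
  induction m with
  | zero => simp
  | succ m ih =>
    have h := rpow_add_le (x := (m : ℝ) + 1 + 1) (s := -1) (p := 1 - b) (by positivity)
      (by ring_nf; positivity) (by linarith) (by linarith)
    rw [Finset.sum_range_succ, mul_add]
    push_cast
    rw [show 1 - b - 1 = -b by ring, show (m : ℝ) + 1 + 1 + -1 = m + 1 by ring] at h
    linarith

/-- The subcritical susceptibility bound for sums of powers; here `L` and `Q` stand for the sums of
the weights and of their squares. -/
lemma sq_div_sub_le {a t N S₁ S₂ L Q : ℝ} (ha0 : 0 < a) (ha1 : a < 1) (ht0 : 0 < t)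
    (hta : t * (1 - a) = 1 - 2 * a) (hN0 : 0 < N) (hn : 1 ≤ a * N ^ a)
    (hL : L = t * N ^ a * S₁) (hQ : Q = t ^ 2 * N ^ (2 * a) * S₂) (hL0 : 0 ≤ L)
    (hS1 : N ^ (1 - a) - 1 ≤ (1 - a) * S₁) (hS2 : (1 - a) * S₁ ≤ N ^ (1 - a))
    (hS3 : (1 - 2 * a) * S₂ ≤ N ^ (1 - 2 * a) - 2 * a) :
    Q < L ∧ L ^ 2 / (L - Q) ≤ t / (a * (1 - a)) * (N ^ (1 - a)) ^ 2 := by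
  have h1a : 0 < 1 - a := sub_pos.2 ha1
  have hmul (b : ℝ) : N ^ b * N ^ (1 - b) = N := by
    rw [← Real.rpow_add hN0, add_sub_cancel, Real.rpow_one]
  have hsq : N ^ (2 * a) = N ^ a * N ^ a := by rw [← Real.rpow_add hN0]; ring_nf
  have hNa : 0 < N ^ a := by positivity
  have hLup : L * (1 - a) ≤ t * N := by
    calc L * (1 - a) = t * N ^ a * ((1 - a) * S₁) := by rw [hL]; ring
      _ ≤ t * N ^ a * N ^ (1 - a) := by gcongr
      _ = t * N := by rw [mul_assoc, hmul]
  have hLlow : t * (N - N ^ a) ≤ L * (1 - a) := by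
    calc t * (N - N ^ a) = t * N ^ a * (N ^ (1 - a) - 1) := by linear_combination -t * hmul a
      _ ≤ t * N ^ a * ((1 - a) * S₁) := by gcongr
      _ = L * (1 - a) := by rw [hL]; ring
  have hQup : Q * (1 - a) ≤ t * (N - 2 * a * N ^ (2 * a)) := by
    calc Q * (1 - a) = t * N ^ (2 * a) * ((1 - 2 * a) * S₂) := by rw [hQ, ← hta]; ring
      _ ≤ t * N ^ (2 * a) * (N ^ (1 - 2 * a) - 2 * a) := by
          gcongr
      _ = t * (N - 2 * a * N ^ (2 * a)) := by linear_combination t * hmul (2 * a)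
  -- The terms `t * N` cancel, leaving `t * (2 * a * N ^ (2 * a) - N ^ a)`; `hn` absorbs `N ^ a`
  -- into half of the first term.
  have hgap : t * a * N ^ (2 * a) ≤ (L - Q) * (1 - a) := by
    have h : N ^ a ≤ a * N ^ (2 * a) := by rw [hsq]; nlinarith
    nlinarith [mul_le_mul_of_nonneg_left h ht0.le]
  have hQL : Q < L := by
    have : 0 < (L - Q) * (1 - a) := lt_of_lt_of_le (by positivity) hgap
    linarith [(mul_pos_iff_of_pos_right h1a).1 this]
  refine ⟨hQL, ?_⟩
  have hK : N ^ (2 * a) * (N ^ (1 - a)) ^ 2 = N ^ 2 := by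
    rw [hsq]
    linear_combination (N ^ a * N ^ (1 - a) + N) * hmul a
  rw [div_le_iff₀ (sub_pos.2 hQL)]
  have h1 : (L * (1 - a)) ^ 2 ≤ (t * N) ^ 2 := by gcongr
  have h2 := mul_le_mul_of_nonneg_left hgap
    (show 0 ≤ t / a * (N ^ (1 - a)) ^ 2 by positivity)
  have h3 : t / a * (N ^ (1 - a)) ^ 2 * (t * a * N ^ (2 * a)) = (t * N) ^ 2 := by
    rw [mul_pow t N, ← hK]
    field_simp
  refine le_of_mul_le_mul_right (?_ : _ * (1 - a) ^ 2 ≤ _ * (1 - a) ^ 2) (by positivity)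
  calc L ^ 2 * (1 - a) ^ 2 = (L * (1 - a)) ^ 2 := by ring
    _ ≤ t / a * (N ^ (1 - a)) ^ 2 * ((L - Q) * (1 - a)) := (h1.trans h3.ge).trans h2
    _ = _ := by field_simp

end NorrosReittu

/-! ### Assembly at criticality -/

open NorrosReittu

theorem theorem3p2 (μ : Measure ℝ) [IsProbabilityMeasure μ] (τ cF : ℝ)
    (hτ₃ : 3 < τ) (hτ₄ : τ < 4) (hcF : 0 < cF)
    (hF : ∀ x : ℝ, 0 < x → 1 - cdf μ x = min 1 (cF * x ^ (-(τ - 1))))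
    (hν : NorrosReittu.nu μ = 1) :
    ∃ c : ℝ, 0 < c ∧ ∀ ω : ℝ, 1 < ω → ∀ᶠ n : ℕ in atTop,
      (NorrosReittu.law (NorrosReittu.weight (cdf μ) n)).real
        {G | ω * (n : ℝ) ^ ((τ - 2) / (τ - 1)) < (NorrosReittu.maxClusterSize G : ℝ)} ≤ c / ω := by
  have hr : 0 < τ - 1 := by linarith
  obtain ⟨a, ha⟩ : ∃ a, a = (τ - 1)⁻¹ := ⟨_, rfl⟩
  obtain ⟨t, ht⟩ : ∃ t, t = cF ^ (τ - 1)⁻¹ := ⟨_, rfl⟩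
  have ha0 : 0 < a := by rw [ha]; positivity
  have hat : a * (τ - 1) = 1 := by rw [ha, inv_mul_cancel₀ hr.ne']
  have ha2 : a < 1 / 2 := by nlinarith
  have ht0 : 0 < t := by rw [ht]; positivity
  have hta : t * (1 - a) = 1 - 2 * a := by
    rw [eq_paretoMeasure μ hr hcF hF, ← ht, nu_paretoMeasure ht0 (by linarith),
      div_eq_one_iff_eq (by linarith)] at hν
    linear_combination a * hν + (1 - t) * hat
  have hexp : (τ - 2) / (τ - 1) = 1 - a := by
    rw [div_eq_iff hr.ne']
    linear_combination hat
  have h1a : 0 < 1 - a := by linarith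
  -- The `1` pays for the `n` one-vertex paths, the fraction for the longer ones.
  refine ⟨1 + t / (a * (1 - a)), by positivity, fun ω hω => ?_⟩
  have hlarge : ∀ᶠ n : ℕ in atTop, 1 ≤ a * (n : ℝ) ^ a :=
    (((tendsto_rpow_atTop ha0).comp tendsto_natCast_atTop_atTop).const_mul_atTop
      ha0).eventually_ge_atTop 1
  filter_upwards [hlarge, eventually_ge_atTop 2] with n hn hn2
  obtain ⟨m, rfl⟩ : ∃ m, n = m + 2 := ⟨n - 2, by omega⟩
  obtain ⟨N, hN⟩ : ∃ N : ℝ, N = (m : ℝ) + 2 := ⟨_, rfl⟩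
  have hN0 : 0 < N := by rw [hN]; positivity
  have hN1 : 1 ≤ N := by rw [hN]; linarith [(Nat.cast_nonneg m : (0 : ℝ) ≤ m)]
  have hcast : ((m + 2 : ℕ) : ℝ) = N := by rw [hN]; push_cast; rfl
  have hcast' : ((m + 1 : ℕ) : ℝ) + 1 = N := by rw [hN]; push_cast; ring
  have hle : (m : ℝ) + 1 ≤ N := by rw [hN]; linarith
  have hmono := monotone_cdf μ
  have hL := sum_weight_pow hmono hr hcF hF (m + 1) one_ne_zero
  have hQ := sum_weight_pow hmono hr hcF hF (m + 1) two_ne_zero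
  simp only [pow_one, Nat.cast_one, one_mul, Nat.cast_ofNat, ← ht, hcast'] at hL hQ
  rw [← ha] at hL hQ
  have hS1 := le_mul_sum_rpow ha0.le (by linarith) (m + 1)
  have hS2 := mul_sum_rpow_le ha0.le (by linarith) m
  have hS3 := mul_sum_rpow_le (b := 2 * a) (by linarith) (by linarith) m
  rw [hcast'] at hS1
  rw [hcast] at hn ⊢
  set S₁ := ∑ k ∈ Finset.range (m + 1), ((k : ℝ) + 1) ^ (-a)
  set S₂ := ∑ k ∈ Finset.range (m + 1), ((k : ℝ) + 1) ^ (-(2 * a))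
  set L := ∑ i, weight (cdf μ) (m + 1 + 1) i
  set Q := ∑ i, weight (cdf μ) (m + 1 + 1) i ^ 2
  have hL0 : 0 ≤ L := Finset.sum_nonneg fun i _ => weight_nonneg hmono hr hcF hF _ i
  have hup (b : ℝ) (hb : b ≤ 1) : ((m : ℝ) + 1) ^ (1 - b) ≤ N ^ (1 - b) :=
    Real.rpow_le_rpow (by positivity) hle (by linarith)
  -- Since `a < 1/2`, the exponent `2 * (1 - a)` exceeds `1`.
  have hNle : N ≤ (N ^ (1 - a)) ^ 2 := by
    rw [← Real.rpow_mul_natCast hN0.le]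
    exact Real.self_le_rpow_of_one_le hN1 (by push_cast; linarith)
  obtain ⟨hQL, hfrac⟩ := sq_div_sub_le ha0 (by linarith) ht0 hta hN0 hn hL hQ hL0 hS1
    (by linarith [hup a (by linarith)]) (by linarith [hup (2 * a) (by linarith)])
  have hω0 : 0 < ω := by linarith
  rw [hexp]
  refine (law_real_lt_maxClusterSize_le (weight_nonneg hmono hr hcF hF (m + 2)) hQL
    (K := ω * N ^ (1 - a)) (by positivity)).trans ?_
  rw [hcast, div_le_div_iff₀ (by positivity) hω0]
  have hsum : N + L ^ 2 / (L - Q) ≤ (1 + t / (a * (1 - a))) * (N ^ (1 - a)) ^ 2 := by linarith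
  -- Markov's inequality gives order `1/ω²`; `ω > 1` weakens it to `1/ω`.
  calc (N + L ^ 2 / (L - Q)) * ω ≤ (1 + t / (a * (1 - a))) * (N ^ (1 - a)) ^ 2 * ω := by gcongr
    _ ≤ (1 + t / (a * (1 - a))) * (N ^ (1 - a)) ^ 2 * (ω * ω) := by
        gcongr
        nlinarith
    _ = (1 + t / (a * (1 - a))) * (ω * N ^ (1 - a)) ^ 2 := by ring
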